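/- Let $\mathcal{X}$ be a complete separable metric space equipped with its Borel $\sigma$-field $\mathcal{S}$, and let $\mathcal{C}\subseteq\mathcal{S}$ be a countable family of sets with finite VC dimension, that is, there is an integer $V$ such that every finite set $D\subseteq\mathcal{X}$ with $|\{C\cap D : C\in\mathcal{C}\}| = 2^{|D|}$ has at most $V$ elements. Then for every stationary ergodic process $\mathbf{X}=X_1,X_2,\ldots$ taking values in $(\mathcal{X},\mathcal{S})$ (that is, $(X_2,X_3,\ldots)$ has the same law as $(X_1,X_2,\ldots)$, and every shift-invariant measurable set of sequences contains the path of $\mathbf{X}$ with probability $0$ or $1$), \[ \Gamma_m(\mathcal{C}:\mathbf{X}) = \sup_{C\in\mathcal{C}} \left| \frac1m \sum_{i=1}^m I(X_i\in C) - \mathbb{P}(X_1\in C)\right| \to 0 \quad\text{with probability one as } m\to\infty . \] In other words, $\mathcal{C}$ is a Glivenko–Cantelli class for every stationary ergodic process. -/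

import Mathlib

open MeasureTheory ProbabilityTheory Filter Topology
open scoped ENNReal

namespace ErgodicVC

noncomputable section

/-- The shatter coefficient `S(D : 𝒞)`: the number of distinct sets `C ∩ D` with `C ∈ 𝒞`. -/
def shatterCoeff {S : Type*} (D : Finset S) (𝒞 : Set (Set S)) : ℕ :=
  Set.ncard ((fun C : Set S => C ∩ (D : Set S)) '' 𝒞)

/-- The family `𝒞` shatters the finite set `D` if `S(D : 𝒞) = 2 ^ |D|`. -/
def Shatters {S : Type*} (𝒞 : Set (Set S)) (D : Finset S) : Prop :=
  shatterCoeff D 𝒞 = 2 ^ D.card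

/-- The VC dimension: the supremum in `ℕ∞` of the cardinalities of the finite sets
shattered by `𝒞` (it is `0` if `𝒞` shatters no nonempty finite set). -/
def vcDim {S : Type*} (𝒞 : Set (Set S)) : ℕ∞ :=
  ⨆ (D : Finset S) (_ : Shatters 𝒞 D), (D.card : ℕ∞)

/-- The left shift on one-sided sequences. -/
def shift {S : Type*} (x : ℕ → S) : ℕ → S := fun n => x (n + 1)

/-- The process `X 0, X 1, …` is stationary: `(X 1, X 2, …)` has the same law on the
sequence space as `(X 0, X 1, …)`. -/
def IsStationary {Ω S : Type*} [MeasurableSpace Ω] [MeasurableSpace S]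
    (X : ℕ → Ω → S) (P : Measure Ω) : Prop :=
  IdentDistrib (fun ω n => X (n + 1) ω) (fun ω n => X n ω) P P

/-- The invariant sigma-field of the process is trivial: every shift-invariant measurable
set of sequences contains the path of the process with probability `0` or `1`. -/
def IsErgodic {Ω S : Type*} [MeasurableSpace Ω] [MeasurableSpace S]
    (X : ℕ → Ω → S) (P : Measure Ω) : Prop :=
  ∀ B : Set (ℕ → S), MeasurableSet B → shift ⁻¹' B = B →
    P {ω | (fun n => X n ω) ∈ B} = 0 ∨ P {ω | (fun n => X n ω) ∈ B} = 1

/-- The relative frequency of `C` among the first `m` samples `X 0, …, X (m - 1)`. -/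
def relFreq {Ω S : Type*} (X : ℕ → Ω → S) (C : Set S) (m : ℕ) (ω : Ω) : ℝ :=
  (1 / (m : ℝ)) * ∑ i ∈ Finset.range m, C.indicator (fun _ => (1 : ℝ)) (X i ω)

/-- `Γ_m(𝒞 : X)`: the supremum over `C ∈ 𝒞` of the distance between the relative frequency
of `C` and its probability under the common law of the samples. -/
def Gam {Ω S : Type*} [MeasurableSpace Ω] (P : Measure Ω)
    (𝒞 : Set (Set S)) (X : ℕ → Ω → S) (m : ℕ) (ω : Ω) : ℝ :=
  ⨆ C : 𝒞, |relFreq X (C : Set S) m ω - P.real {ω' | X 0 ω' ∈ (C : Set S)}|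

/-- `𝒞` is a Glivenko–Cantelli class for the process `X`. -/
def IsGlivenkoCantelli {Ω S : Type*} [MeasurableSpace Ω] (P : Measure Ω)
    (𝒞 : Set (Set S)) (X : ℕ → Ω → S) : Prop :=
  ∀ᵐ ω ∂P, Tendsto (fun m : ℕ => Gam P 𝒞 X m ω) atTop (𝓝 0)

/-- The terms of the supremum in `Gam` are bounded by `1`, so that for a probability measure
the real supremum is the genuine one. -/
theorem bddAbove_Gam {Ω S : Type*} [MeasurableSpace Ω] (P : Measure Ω)
    [IsProbabilityMeasure P] (𝒞 : Set (Set S)) (X : ℕ → Ω → S) (m : ℕ) (ω : Ω) :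
    BddAbove (Set.range fun C : 𝒞 =>
      |relFreq X (C : Set S) m ω - P.real {ω' | X 0 ω' ∈ (C : Set S)}|) := by
  refine ⟨1, ?_⟩
  rintro _ ⟨C, rfl⟩
  have h0 : 0 ≤ relFreq X (C : Set S) m ω :=
    mul_nonneg (by positivity)
      (Finset.sum_nonneg fun i _ => Set.indicator_nonneg (fun _ _ => zero_le_one) _)
  have h1 : relFreq X (C : Set S) m ω ≤ 1 := by
    have hs : ∑ i ∈ Finset.range m, (C : Set S).indicator (fun _ => (1 : ℝ)) (X i ω) ≤ m := by
      calc _ ≤ ∑ i ∈ Finset.range m, (1 : ℝ) :=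
            Finset.sum_le_sum fun i _ => Set.indicator_le_self' (fun _ _ => zero_le_one) _
        _ = m := by simp
    unfold relFreq
    rw [one_div, inv_mul_eq_div]
    exact div_le_one_of_le₀ hs (Nat.cast_nonneg m)
  have h2 : 0 ≤ P.real {ω' | X 0 ω' ∈ (C : Set S)} := measureReal_nonneg
  have h3 : P.real {ω' | X 0 ω' ∈ (C : Set S)} ≤ 1 := measureReal_le_one
  exact abs_le.2 ⟨by linarith, by linarith⟩

end

end ErgodicVC

/-
Finite VC dimension forces finite bracketing numbers for the law `μ` of `X 0`, and bracketing
reduces the uniform statement to Birkhoff's theorem for the finitely many end points of brackets.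

By compactness of the space of ultrafilters, brackets are only needed along one ultrafilter `𝒰` on
`𝒞`. If on some non-null set `W` the sets `C` split every non-null measurable `A ⊆ W` into two
non-null pieces for `𝒰`-most `C`, then choosing sets one after the other gives independent families
of every finite size in `𝒞`, hence shattered sets of every size. So every non-null `W` contains a
non-null `A` that `𝒰`-most `C` contain, or avoid, up to null sets. Exhausting the space by such
`A`, the traces of `𝒰`-most `C` agree with a fixed set `L` on some `D` of nearly full measure, and
`[L ∩ D, L ∪ Dᶜ]` is the required bracket.
-/

namespace ErgodicVC

section BirkhoffTheorem

section OrderedGroup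

variable {α M : Type*} [AddCommGroup M] [Lattice M] [AddLeftMono M]

theorem partialSups_birkhoffSum_succ (T : α → α) (f : α → M) (n : ℕ) (x : α) :
    partialSups (birkhoffSum T f) (n + 1) x =
      0 ⊔ (f x + partialSups (birkhoffSum T f) n (T x)) := by
  induction n with
  | zero =>
    change partialSups (birkhoffSum T f) (Order.succ 0) x = _
    rw [partialSups_succ, partialSups_zero]
    simp
  | succ n ih =>
    rw [← Order.succ_eq_add_one (n + 1), partialSups_succ, Pi.sup_apply, ih,
      ← Order.succ_eq_add_one n, partialSups_succ, Pi.sup_apply, add_sup, ← sup_assoc]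
    exact congrArg _ (birkhoffSum_succ' T f (n + 1) x)

theorem bddAbove_range_birkhoffSum_map_iff (T : α → α) (f : α → M) (x : α) :
    BddAbove (Set.range fun n => birkhoffSum T f n (T x)) ↔
      BddAbove (Set.range fun n => birkhoffSum T f n x) := by
  constructor
  · rintro ⟨K, hK⟩
    refine ⟨0 ⊔ (f x + K), ?_⟩
    rintro _ ⟨n | n, rfl⟩
    · exact le_sup_left
    · simpa only [birkhoffSum_succ'] using
        le_sup_of_le_right (add_le_add_right (hK ⟨n, rfl⟩) (f x))
  · rintro ⟨K, hK⟩
    refine ⟨K - f x, ?_⟩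
    rintro _ ⟨n, rfl⟩
    exact le_sub_iff_add_le'.2 (birkhoffSum_succ' T f n x ▸ hK ⟨n + 1, rfl⟩)

end OrderedGroup

variable {α : Type*} [MeasurableSpace α] {ν : Measure α} {T : α → α} {f : α → ℝ}

theorem integrable_birkhoffSum {E : Type*} [NormedAddCommGroup E] {f : α → E}
    (hT : MeasurePreserving T ν ν) (hf : Integrable f ν) (n : ℕ) :
    Integrable (birkhoffSum T f n) ν :=
  integrable_finsetSum _ fun k _ => (hT.iterate k).integrable_comp_of_integrable hf

theorem integrable_partialSups_birkhoffSum (hT : MeasurePreserving T ν ν) (hf : Integrable f ν)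
    (n : ℕ) : Integrable (partialSups (birkhoffSum T f) n) ν := by
  induction n with
  | zero => exact integrable_birkhoffSum hT hf 0
  | succ n ih =>
    rw [← Order.succ_eq_add_one, partialSups_succ]
    exact ih.sup (integrable_birkhoffSum hT hf (n + 1))

/- With `M n` the maximum of the first `n` Birkhoff sums, `M (n + 1) - M n ∘ T` is
`max (-(M n ∘ T)) f`; its integral is that of `M (n + 1) - M n ≥ 0`, and it equals `f` at a point
as soon as one of the first `n + 1` nontrivial Birkhoff sums at that point is nonnegative. -/
theorem integral_nonneg_of_ae_exists_birkhoffSum_nonneg (hT : MeasurePreserving T ν ν)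
    (hf : Integrable f ν) (h : ∀ᵐ x ∂ν, ∃ n, 0 ≤ birkhoffSum T f (n + 1) x) :
    0 ≤ ∫ x, f x ∂ν := by
  set M := partialSups (birkhoffSum T f)
  have hM : ∀ n, Integrable (M n) ν := integrable_partialSups_birkhoffSum hT hf
  have hMT : ∀ n, Integrable (fun x => M n (T x)) ν := fun n =>
    hT.integrable_comp_of_integrable (hM n)
  have hM_nonneg : ∀ n x, 0 ≤ M n x := fun n x => by
    simpa using le_partialSups_of_le (birkhoffSum T f) n.zero_le x
  have hM_succ_sub : ∀ n x, M (n + 1) x - M n (T x) = max (-M n (T x)) (f x) := fun n x => by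
    rw [show M (n + 1) x = max 0 (f x + M n (T x)) from partialSups_birkhoffSum_succ T f n x,
      ← max_sub_sub_right, zero_sub, add_sub_cancel_right]
  have hint_nonneg : ∀ n, 0 ≤ ∫ x, max (-M n (T x)) (f x) ∂ν := fun n => by
    have hmap : ∫ x, M n (T x) ∂ν = ∫ x, M n x ∂ν := by
      conv_rhs => rw [← hT.map_eq]
      exact (integral_map hT.measurable.aemeasurable
        (hT.map_eq.symm ▸ (hM n).aestronglyMeasurable)).symm
    simp only [← hM_succ_sub]
    rw [integral_sub (hM (n + 1)) (hMT n), hmap, sub_nonneg]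
    exact integral_mono (hM n) (hM (n + 1)) (M.monotone n.le_succ)
  refine ge_of_tendsto' (tendsto_integral_of_dominated_convergence (fun x => |f x|)
    (fun n => ((hMT n).neg.sup hf).aestronglyMeasurable) hf.abs
    (fun n => .of_forall fun x => ?bound) ?limit) hint_nonneg
  case bound =>
    exact abs_le.2 ⟨(neg_abs_le _).trans (le_max_right _ _),
      max_le ((neg_nonpos.2 (hM_nonneg n _)).trans (abs_nonneg _)) (le_abs_self _)⟩
  case limit =>
    filter_upwards [h] with x ⟨N, hN⟩
    refine tendsto_const_nhds.congr' ?_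
    filter_upwards [eventually_ge_atTop N] with n hn
    have hle : birkhoffSum T f N (T x) ≤ M n (T x) :=
      le_partialSups_of_le (birkhoffSum T f) hn (T x)
    rw [birkhoffSum_succ'] at hN
    have hle' : -M n (T x) ≤ f x := by linarith
    exact (max_eq_right hle').symm

theorem nullMeasurableSet_bddAbove_range_birkhoffSum (hT : Measure.QuasiMeasurePreserving T ν ν)
    (hf : AEMeasurable f ν) :
    NullMeasurableSet {x | BddAbove (Set.range fun n => birkhoffSum T f n x)} ν := by
  have hmeas : ∀ n, Measurable (birkhoffSum T (hf.mk f) n) := fun n =>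
    Finset.measurable_sum _ fun k _ => hf.measurable_mk.comp (hT.measurable.iterate k)
  refine (measurableSet_bddAbove_range hmeas).nullMeasurableSet.congr ?_
  filter_upwards [ae_all_iff.2 (hT.birkhoffSum_ae_eq_of_ae_eq hf.ae_eq_mk)] with x hx
  exact congrArg (fun u : ℕ → ℝ => BddAbove (Set.range u)) (funext fun n => (hx n).symm)

theorem ae_bddAbove_range_birkhoffSum (hT : Ergodic T ν) (hf : Integrable f ν)
    (hneg : ∫ x, f x ∂ν < 0) :
    ∀ᵐ x ∂ν, BddAbove (Set.range fun n => birkhoffSum T f n x) := by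
  refine (hT.quasiErgodic.ae_mem_or_ae_notMem₀
    (nullMeasurableSet_bddAbove_range_birkhoffSum hT.quasiErgodic.toQuasiMeasurePreserving
      hf.aemeasurable)
    (.of_eq <| Set.ext (bddAbove_range_birkhoffSum_map_iff T f))).resolve_right fun h => ?_
  refine hneg.not_ge
    (integral_nonneg_of_ae_exists_birkhoffSum_nonneg hT.toMeasurePreserving hf ?_)
  filter_upwards [h] with x hx
  by_contra! hlt
  refine hx ⟨0, ?_⟩
  rintro _ ⟨n | n, rfl⟩
  exacts [le_rfl, (hlt n).le]

theorem ae_eventually_birkhoffAverage_lt [IsProbabilityMeasure ν] (hT : Ergodic T ν)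
    (hf : Integrable f ν) {c : ℝ} (hc : ∫ x, f x ∂ν < c) :
    ∀ᵐ x ∂ν, ∀ᶠ n in atTop, birkhoffAverage ℝ T f n x < c := by
  obtain ⟨b, hfb, hbc⟩ := exists_between hc
  have hneg : ∫ x, (f x - b) ∂ν < 0 := by
    simpa [integral_sub hf (integrable_const b)] using hfb
  filter_upwards [ae_bddAbove_range_birkhoffSum hT (hf.sub (integrable_const b)) hneg]
    with x ⟨K, hK⟩
  have hlim : Tendsto (fun n : ℕ => b + K / n) atTop (𝓝 b) := by
    simpa using (tendsto_const_div_atTop_nhds_zero_nat K).const_add b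
  filter_upwards [hlim.eventually_lt_const hbc, eventually_gt_atTop 0] with n hn hpos
  have hn0 : (n : ℝ) ≠ 0 := mod_cast hpos.ne'
  have hsum : birkhoffSum T f n x - n * b ≤ K := by
    simpa [birkhoffSum] using hK ⟨n, rfl⟩
  calc birkhoffAverage ℝ T f n x = birkhoffSum T f n x / n := by
        rw [birkhoffAverage, smul_eq_mul, inv_mul_eq_div]
    _ ≤ (n * b + K) / n := by gcongr; linarith
    _ = b + K / n := by field_simp
    _ < c := hn

theorem ae_forall_gt_eventually_birkhoffAverage_lt [IsProbabilityMeasure ν] (hT : Ergodic T ν)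
    (hf : Integrable f ν) :
    ∀ᵐ x ∂ν, ∀ c > ∫ x, f x ∂ν, ∀ᶠ n in atTop, birkhoffAverage ℝ T f n x < c := by
  have hrat : ∀ᵐ x ∂ν, ∀ q : ℚ, ∫ x, f x ∂ν < q →
      ∀ᶠ n in atTop, birkhoffAverage ℝ T f n x < q :=
    ae_all_iff.2 fun q => eventually_imp_distrib_left.2 fun hq =>
      ae_eventually_birkhoffAverage_lt hT hf hq
  filter_upwards [hrat] with x hx c hc
  obtain ⟨q, hq, hqc⟩ := exists_rat_btwn hc
  exact (hx q hq).mono fun n hn => hn.trans hqc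

theorem ae_tendsto_birkhoffAverage [IsProbabilityMeasure ν] (hT : Ergodic T ν)
    (hf : Integrable f ν) :
    ∀ᵐ x ∂ν, Tendsto (fun n => birkhoffAverage ℝ T f n x) atTop (𝓝 (∫ x, f x ∂ν)) := by
  filter_upwards [ae_forall_gt_eventually_birkhoffAverage_lt hT hf,
    ae_forall_gt_eventually_birkhoffAverage_lt hT hf.neg] with x hupper hlower
  refine tendsto_order.2 ⟨fun c hc => ?_, hupper⟩
  refine (hlower (-c) (by simpa [integral_neg] using hc)).mono fun n hn => ?_
  simpa [birkhoffAverage_neg] using hn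

end BirkhoffTheorem

section Shattering

variable {S : Type*} {𝒞 : Set (Set S)}

theorem Shatters.card_le_vcDim {D : Finset S} (h : Shatters 𝒞 D) : (D.card : ℕ∞) ≤ vcDim 𝒞 :=
  le_iSup₂ (f := fun (E : Finset S) (_ : Shatters 𝒞 E) => (E.card : ℕ∞)) D h

theorem shatters_of_forall_subset {D : Finset S}
    (h : ∀ B ⊆ (D : Set S), ∃ C ∈ 𝒞, C ∩ D = B) : Shatters 𝒞 D := by
  have himage : (fun C : Set S => C ∩ (D : Set S)) '' 𝒞 = 𝒫 (D : Set S) :=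
    Set.Subset.antisymm (Set.image_subset_iff.2 fun C _ => Set.inter_subset_right) h
  rw [Shatters, shatterCoeff, himage, Set.ncard_powerset _ D.finite_toSet, Set.ncard_coe_finset]

/-- The atom, labelled by the index set `s`, of the algebra of sets generated by the family `F`:
the points lying in exactly those `F i` with `i ∈ s`. The family is independent when no atom is
empty. -/
def atom {ι : Type*} (F : ι → Set S) (s : Set ι) : Set S :=
  {x | ∀ i, x ∈ F i ↔ i ∈ s}

section Atom

variable {ι : Type*} {F : ι → Set S} {C : Set S}

theorem measurableSet_atom [MeasurableSpace S] [Countable ι] (hF : ∀ i, MeasurableSet (F i))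
    (s : Set ι) : MeasurableSet (atom F s) := by
  rw [atom, Set.ofPred_forall]
  exact .iInter fun i => (hF i).iff (.const (i ∈ s))

theorem atom_comp_equiv {κ : Type*} (e : κ ≃ ι) (s : Set κ) :
    atom (F ∘ e) s = atom F (e.symm ⁻¹' s) := by
  ext x
  simp [atom, e.forall_congr_left]

theorem atom_option_elim_of_mem {s : Set (Option ι)} (hs : none ∈ s) :
    atom (fun o => o.elim C F) s = atom F (some ⁻¹' s) ∩ C := by
  ext x
  simp [atom, Option.forall, hs, and_comm]

theorem atom_option_elim_of_notMem {s : Set (Option ι)} (hs : none ∉ s) :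
    atom (fun o => o.elim C F) s = atom F (some ⁻¹' s) \ C := by
  ext x
  simp [atom, Option.forall, hs, and_comm]

end Atom

/- The point attached to `a` is taken in exactly those sets whose label `T` contains `a`. -/
theorem exists_shatters_of_forall_atom_nonempty {ι : Type*} [Fintype ι] {F : Set ι → Set S}
    (hF : ∀ T, F T ∈ 𝒞) (hind : ∀ s, (atom F s).Nonempty) :
    ∃ D : Finset S, D.card = Fintype.card ι ∧ Shatters 𝒞 D := by
  classical
  choose d hd using fun a : ι => hind {T | a ∈ T}
  have hinj : Function.Injective d := fun a b hab => by
    have hb : d b ∈ F {a} := hab ▸ (hd a {a}).2 rfl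
    exact ((hd b {a}).1 hb).symm
  refine ⟨Finset.univ.image d, Finset.card_image_of_injective _ hinj,
    shatters_of_forall_subset fun B hB => ⟨F (d ⁻¹' B), hF _, ?_⟩⟩
  rw [Finset.coe_image, Finset.coe_univ, Set.image_univ] at hB ⊢
  calc F (d ⁻¹' B) ∩ Set.range d = d '' (d ⁻¹' F (d ⁻¹' B)) :=
        Set.image_preimage_eq_inter_range.symm
    _ = d '' (d ⁻¹' B) := congrArg _ (Set.ext fun a => hd a (d ⁻¹' B))
    _ = B := Set.image_preimage_eq_of_subset hB

variable [MeasurableSpace S] {μ : Measure S} {W : Set S}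

theorem exists_measure_inter_atom_ne_zero {𝒰 : Filter (Set S)} [𝒰.NeBot] (h𝒰 : 𝒞 ∈ 𝒰)
    (hmeas : ∀ C ∈ 𝒞, MeasurableSet C) (hW : MeasurableSet W) (hW0 : μ W ≠ 0)
    (hsplit : ∀ A ⊆ W, MeasurableSet A → μ A ≠ 0 → ∀ᶠ C in 𝒰, μ (A ∩ C) ≠ 0 ∧ μ (A \ C) ≠ 0)
    (ι : Type*) [Finite ι] :
    ∃ F : ι → Set S, (∀ i, F i ∈ 𝒞) ∧ ∀ s, μ (W ∩ atom F s) ≠ 0 := by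
  induction ι using Finite.induction_empty_option with
  | of_equiv e ih =>
    obtain ⟨F, hF, hFs⟩ := ih
    exact ⟨F ∘ e.symm, fun i => hF _, fun s => atom_comp_equiv e.symm s ▸ hFs _⟩
  | h_empty => exact ⟨PEmpty.elim, fun i => i.elim, fun s => by simpa [atom] using hW0⟩
  | @h_option ι _ ih =>
    obtain ⟨F, hF, hFs⟩ := ih
    have hev : ∀ᶠ C in 𝒰, ∀ s : Set ι,
        μ (W ∩ atom F s ∩ C) ≠ 0 ∧ μ ((W ∩ atom F s) \ C) ≠ 0 :=
      eventually_all.2 fun s => hsplit _ Set.inter_subset_left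
        (hW.inter (measurableSet_atom (fun i => hmeas _ (hF i)) s)) (hFs s)
    obtain ⟨C, hC, hC𝒞⟩ := (hev.and h𝒰).exists
    refine ⟨fun o => o.elim C F, Option.forall.2 ⟨hC𝒞, hF⟩, fun s => ?_⟩
    by_cases hs : none ∈ s
    · rw [atom_option_elim_of_mem hs, ← Set.inter_assoc]
      exact (hC _).1
    · rw [atom_option_elim_of_notMem hs, ← Set.inter_sdiff_assoc]
      exact (hC _).2

theorem vcDim_eq_top_of_splits {𝒰 : Filter (Set S)} [𝒰.NeBot] (h𝒰 : 𝒞 ∈ 𝒰)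
    (hmeas : ∀ C ∈ 𝒞, MeasurableSet C) (hW : MeasurableSet W) (hW0 : μ W ≠ 0)
    (hsplit : ∀ A ⊆ W, MeasurableSet A → μ A ≠ 0 → ∀ᶠ C in 𝒰, μ (A ∩ C) ≠ 0 ∧ μ (A \ C) ≠ 0) :
    vcDim 𝒞 = ⊤ := by
  refine ENat.eq_top_iff_forall_ge.2 fun n => ?_
  obtain ⟨F, hF, hFs⟩ :=
    exists_measure_inter_atom_ne_zero h𝒰 hmeas hW hW0 hsplit (Set (Fin n))
  obtain ⟨D, hDn, hD⟩ := exists_shatters_of_forall_atom_nonempty hF fun s =>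
    (nonempty_of_measure_ne_zero (hFs s)).right
  simpa [hDn] using hD.card_le_vcDim

end Shattering

section Exhaustion

variable {α : Type*} [MeasurableSpace α] {μ : Measure α} {𝒟 : Set (Set α)}

theorem exists_monotone_tendsto_measure_sSup (μ : Measure α) (hne : 𝒟.Nonempty)
    (hsup : SupClosed 𝒟) :
    ∃ D : ℕ → Set α, Monotone D ∧ (∀ n, D n ∈ 𝒟) ∧
      Tendsto (fun n => μ (D n)) atTop (𝓝 (sSup (μ '' 𝒟))) := by
  obtain ⟨u, -, hu, hu𝒟⟩ := exists_seq_tendsto_sSup (hne.image μ) (OrderTop.bddAbove _)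
  choose D hD hDu using hu𝒟
  have hmem : ∀ n, partialSups D n ∈ 𝒟 := fun n =>
    partialSups_apply D n ▸ hsup.finsetSup'_mem _ fun i _ => hD i
  refine ⟨partialSups D, (partialSups D).monotone, hmem,
    tendsto_of_tendsto_of_tendsto_of_le_of_le hu tendsto_const_nhds (fun n => ?_)
      fun n => le_sSup (Set.mem_image_of_mem μ (hmem n))⟩
  exact hDu n ▸ measure_mono (le_partialSups D n)

theorem exists_mem_measure_compl_lt [IsFiniteMeasure μ] (hne : 𝒟.Nonempty) (hsup : SupClosed 𝒟)
    (hmeas : ∀ D ∈ 𝒟, MeasurableSet D)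
    (hsub : ∀ W, MeasurableSet W → μ W ≠ 0 → ∃ A ∈ 𝒟, A ⊆ W ∧ μ A ≠ 0)
    {ε : ℝ≥0∞} (hε : 0 < ε) : ∃ D ∈ 𝒟, μ Dᶜ < ε := by
  obtain ⟨D, hmono, hD, hlim⟩ := exists_monotone_tendsto_measure_sSup μ hne hsup
  have hnull : μ (⋃ n, D n)ᶜ = 0 := by
    by_contra hpos
    obtain ⟨A, hA, hAsub, hA0⟩ := hsub _ (MeasurableSet.iUnion fun n => hmeas _ (hD n)).compl hpos
    have hadd : ∀ n, μ (D n) + μ A ≤ sSup (μ '' 𝒟) := fun n => by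
      have hdisj : Disjoint (D n) A :=
        (Set.subset_compl_iff_disjoint_left.1 hAsub).mono_left (Set.subset_iUnion D n)
      rw [← measure_union hdisj (hmeas A hA)]
      exact le_sSup (Set.mem_image_of_mem μ (hsup (hD n) hA))
    have hfin : sSup (μ '' 𝒟) ≠ ⊤ := ne_top_of_le_ne_top (measure_ne_top μ Set.univ)
      (sSup_le (Set.forall_mem_image.2 fun B _ => measure_mono B.subset_univ))
    exact (ENNReal.lt_add_right hfin hA0).not_ge (le_of_tendsto' (hlim.add_const (μ A)) hadd)
  have hcompl : Tendsto (fun n => μ (D n)ᶜ) atTop (𝓝 0) := by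
    rw [← hnull, Set.compl_iUnion]
    exact tendsto_measure_iInter_atTop (fun n => (hmeas _ (hD n)).compl.nullMeasurableSet)
      (fun m n hmn => Set.compl_subset_compl.2 (hmono hmn)) ⟨0, measure_ne_top _ _⟩
  obtain ⟨n, hn⟩ := (hcompl.eventually_lt_const hε).exists
  exact ⟨D n, hD n, hn⟩

end Exhaustion

theorem exists_finite_cover_of_forall_ultrafilter {α ι : Type*} {s : Set α} {I : Set ι}
    {O : ι → Set α} (h : ∀ 𝒰 : Ultrafilter α, s ∈ 𝒰 → ∃ i ∈ I, O i ∈ 𝒰) :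
    ∃ t ⊆ I, t.Finite ∧ s ⊆ ⋃ i ∈ t, O i := by
  obtain ⟨t, htI, ht, hcover⟩ := (ultrafilter_isClosed_basic s).isCompact.elim_finite_subcover_image
    (fun i (_ : i ∈ I) => ultrafilter_isOpen_basic (O i))
    (fun 𝒰 h𝒰 => by simpa using h 𝒰 h𝒰)
  refine ⟨t, htI, ht, fun a ha => ?_⟩
  simpa using hcover (show pure a ∈ {𝒰 : Ultrafilter α | s ∈ 𝒰} from ha)

section Bracketing

variable {S : Type*} [MeasurableSpace S] {μ : Measure S} {𝒞 : Set (Set S)}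

/-- Stability of a class of sets on `D`: along the filter `𝒰`, the sets have the same trace on `D`
up to `μ`-null sets, namely that of a measurable set `L`. -/
def IsStableOn (μ : Measure S) (𝒰 : Filter (Set S)) (D : Set S) : Prop :=
  ∃ L, MeasurableSet L ∧ ∀ᶠ C in 𝒰, ∀ᵐ x ∂μ, x ∈ D → (x ∈ C ↔ x ∈ L)

section IsStableOn

variable {𝒰 : Filter (Set S)} {D E : Set S}

theorem IsStableOn.union (hD : MeasurableSet D) (h : IsStableOn μ 𝒰 D) (h' : IsStableOn μ 𝒰 E) :
    IsStableOn μ 𝒰 (D ∪ E) := by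
  obtain ⟨L, hL, hCL⟩ := h
  obtain ⟨K, hK, hCK⟩ := h'
  refine ⟨D.ite L K, hD.ite hL hK, ?_⟩
  filter_upwards [hCL, hCK] with C hL hK
  filter_upwards [hL, hK] with x hxL hxK hx
  by_cases hxD : x ∈ D
  · simpa [Set.ite, hxD] using hxL hxD
  · simpa [Set.ite, hxD] using hxK (hx.resolve_left hxD)

theorem isStableOn_of_eventually_measure_inter_eq_zero (h : ∀ᶠ C in 𝒰, μ (D ∩ C) = 0) :
    IsStableOn μ 𝒰 D := by
  refine ⟨∅, .empty, h.mono fun C hC => ?_⟩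
  filter_upwards [measure_eq_zero_iff_ae_notMem.1 hC] with x hx hxD
  exact iff_of_false (fun hxC => hx ⟨hxD, hxC⟩) id

theorem isStableOn_of_eventually_measure_sdiff_eq_zero (h : ∀ᶠ C in 𝒰, μ (D \ C) = 0) :
    IsStableOn μ 𝒰 D := by
  refine ⟨Set.univ, .univ, h.mono fun C hC => ?_⟩
  filter_upwards [measure_eq_zero_iff_ae_notMem.1 hC] with x hx hxD
  exact iff_of_true (by_contra fun hxC => hx ⟨hxD, hxC⟩) trivial

end IsStableOn

theorem exists_subset_isStableOn (hmeas : ∀ C ∈ 𝒞, MeasurableSet C) (hdim : vcDim 𝒞 < ⊤)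
    {𝒰 : Ultrafilter (Set S)} (h𝒰 : 𝒞 ∈ 𝒰) {W : Set S} (hW : MeasurableSet W) (hW0 : μ W ≠ 0) :
    ∃ A ⊆ W, MeasurableSet A ∧ μ A ≠ 0 ∧ IsStableOn μ 𝒰 A := by
  by_contra! h
  refine hdim.ne (vcDim_eq_top_of_splits h𝒰 hmeas hW hW0 fun A hAW hA hA0 => .and ?_ ?_)
  · exact Ultrafilter.eventually_not.2 fun hnull =>
      h A hAW hA hA0 (isStableOn_of_eventually_measure_inter_eq_zero hnull)
  · exact Ultrafilter.eventually_not.2 fun hnull =>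
      h A hAW hA hA0 (isStableOn_of_eventually_measure_sdiff_eq_zero hnull)

theorem exists_isStableOn_measure_compl_lt [IsFiniteMeasure μ]
    (hmeas : ∀ C ∈ 𝒞, MeasurableSet C) (hdim : vcDim 𝒞 < ⊤) {𝒰 : Ultrafilter (Set S)}
    (h𝒰 : 𝒞 ∈ 𝒰) {ε : ℝ≥0∞} (hε : 0 < ε) :
    ∃ D, MeasurableSet D ∧ IsStableOn μ 𝒰 D ∧ μ Dᶜ < ε := by
  obtain ⟨D, ⟨hD, hstable⟩, hDε⟩ := exists_mem_measure_compl_lt (μ := μ)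
    (𝒟 := {D | MeasurableSet D ∧ IsStableOn μ 𝒰 D})
    ⟨∅, .empty, isStableOn_of_eventually_measure_inter_eq_zero (by simp)⟩
    (fun D hD E hE => ⟨hD.1.union hE.1, hD.2.union hD.1 hE.2⟩) (fun D hD => hD.1)
    (fun W hW hW0 => by
      obtain ⟨A, hAW, hA, hA0, hstable⟩ := exists_subset_isStableOn hmeas hdim h𝒰 hW hW0
      exact ⟨A, ⟨hA, hstable⟩, hAW, hA0⟩) hε
  exact ⟨D, hD, hstable, hDε⟩

/-- The bracket `[A, B]`: the sets lying between `A` and `B` up to `μ`-null sets. Its size is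
`μ (B \ A)`. -/
def bracket (μ : Measure S) (A B : Set S) : Set (Set S) :=
  {C | A ≤ᵐ[μ] C ∧ C ≤ᵐ[μ] B}

theorem exists_finite_bracket_cover [IsFiniteMeasure μ] (hmeas : ∀ C ∈ 𝒞, MeasurableSet C)
    (hdim : vcDim 𝒞 < ⊤) {ε : ℝ≥0∞} (hε : 0 < ε) :
    ∃ t ⊆ {p : Set S × Set S | MeasurableSet p.1 ∧ MeasurableSet p.2 ∧ μ (p.2 \ p.1) < ε},
      t.Finite ∧ 𝒞 ⊆ ⋃ p ∈ t, bracket μ p.1 p.2 := by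
  refine exists_finite_cover_of_forall_ultrafilter fun 𝒰 h𝒰 => ?_
  obtain ⟨D, hD, ⟨L, hL, hstable⟩, hDε⟩ :=
    exists_isStableOn_measure_compl_lt (μ := μ) hmeas hdim h𝒰 hε
  refine ⟨(L ∩ D, L ∪ Dᶜ), ⟨hL.inter hD, hL.union hD.compl, hDε.trans_le' (measure_mono ?_)⟩, ?_⟩
  · rintro x ⟨hxL | hxD, hx⟩
    exacts [fun hxD => hx ⟨hxL, hxD⟩, hxD]
  · filter_upwards [hstable] with C hC
    constructor
    · filter_upwards [hC] with x hx hxLD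
      exact (hx hxLD.2).2 hxLD.1
    · filter_upwards [hC] with x hx hxC
      exact (em (x ∈ D)).imp_left fun hxD => (hx hxD).1 hxC

end Bracketing

section Sampling

variable {Ω S : Type*} {X : ℕ → Ω → S}

theorem shift_iterate_apply (k : ℕ) (x : ℕ → S) (n : ℕ) : shift^[k] x n = x (n + k) := by
  induction k generalizing x with
  | zero => rfl
  | succ k ih => rw [Function.iterate_succ_apply, ih, shift, add_assoc]

theorem relFreq_eq_birkhoffAverage (X : ℕ → Ω → S) (C : Set S) (m : ℕ) (ω : Ω) :
    relFreq X C m ω =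
      birkhoffAverage ℝ shift (fun x => C.indicator 1 (x 0)) m (fun n => X n ω) := by
  simp only [relFreq, birkhoffAverage, birkhoffSum, shift_iterate_apply, zero_add, smul_eq_mul,
    one_div, Pi.one_def]

theorem relFreq_le_relFreq {A B : Set S} {ω : Ω} (h : ∀ n, X n ω ∈ A → X n ω ∈ B) (m : ℕ) :
    relFreq X A m ω ≤ relFreq X B m ω := by
  refine mul_le_mul_of_nonneg_left (Finset.sum_le_sum fun i _ => ?_) (by positivity)
  by_cases hA : X i ω ∈ A
  · simp [hA, h i hA]
  · rw [Set.indicator_of_notMem hA]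
    exact Set.indicator_nonneg (fun _ _ => zero_le_one) _

theorem abs_relFreq_sub_measureReal_le [MeasurableSpace S] {μ : Measure S} [IsFiniteMeasure μ]
    {A B C : Set S} {m : ℕ} {ω : Ω} {ε : ℝ} (hC : C ∈ bracket μ A B)
    (hgap : μ.real (B \ A) ≤ ε / 2)
    (hAC : ∀ n, X n ω ∈ A → X n ω ∈ C) (hCB : ∀ n, X n ω ∈ C → X n ω ∈ B)
    (hA : |relFreq X A m ω - μ.real A| < ε / 2) (hB : |relFreq X B m ω - μ.real B| < ε / 2) :
    |relFreq X C m ω - μ.real C| ≤ ε := by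
  have hBA : μ.real B - μ.real A ≤ ε / 2 := le_trans le_measureReal_sdiff hgap
  have hμAC : μ.real A ≤ μ.real C :=
    ENNReal.toReal_mono (measure_ne_top _ _) (measure_mono_ae hC.1)
  have hμCB : μ.real C ≤ μ.real B :=
    ENNReal.toReal_mono (measure_ne_top _ _) (measure_mono_ae hC.2)
  rw [abs_lt] at hA hB
  have hfAC := relFreq_le_relFreq hAC m
  have hfCB := relFreq_le_relFreq hCB m
  exact abs_le.2 ⟨by linarith, by linarith⟩

theorem measurable_shift [MeasurableSpace S] : Measurable (shift : (ℕ → S) → ℕ → S) :=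
  measurable_pi_lambda _ fun n => measurable_pi_apply (n + 1)

variable [MeasurableSpace Ω] [MeasurableSpace S] {P : Measure Ω}

theorem IsStationary.aemeasurable_path (hstat : IsStationary X P) :
    AEMeasurable (fun ω n => X n ω) P :=
  hstat.aemeasurable_snd

theorem IsStationary.aemeasurable (hstat : IsStationary X P) (n : ℕ) : AEMeasurable (X n) P :=
  aemeasurable_pi_iff.1 hstat.aemeasurable_path n

theorem IsStationary.map_apply_eq (hstat : IsStationary X P) (n : ℕ) :
    P.map (X n) = P.map (X 0) := by
  induction n with
  | zero => rfl
  | succ n ih => exact (hstat.comp (measurable_pi_apply n)).map_eq.trans ih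

theorem IsStationary.ae_forall_mem_imp (hstat : IsStationary X P) {A B : Set S}
    (h : A ≤ᵐ[P.map (X 0)] B) : ∀ᵐ ω ∂P, ∀ n, X n ω ∈ A → X n ω ∈ B :=
  ae_all_iff.2 fun n => ae_of_ae_map (p := fun x => x ∈ A → x ∈ B) (hstat.aemeasurable n)
    (hstat.map_apply_eq n ▸ h)

variable [IsProbabilityMeasure P]

theorem ergodic_shift (hstat : IsStationary X P) (herg : IsErgodic X P) :
    Ergodic shift (P.map fun ω n => X n ω) := by
  have hpath := hstat.aemeasurable_path
  have := Measure.isProbabilityMeasure_map hpath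
  refine { measurable := measurable_shift, map_eq := ?_, aeconst_set := fun B hB hinv => ?_ }
  · rw [AEMeasurable.map_map_of_aemeasurable measurable_shift.aemeasurable hpath]
    exact IdentDistrib.map_eq hstat
  · rw [eventuallyConst_set', ae_eq_empty, ae_eq_univ, prob_compl_eq_zero_iff hB,
      Measure.map_apply_of_aemeasurable hpath hB]
    exact herg B hB hinv

theorem ae_tendsto_relFreq (hstat : IsStationary X P) (herg : IsErgodic X P) {C : Set S}
    (hC : MeasurableSet C) :
    ∀ᵐ ω ∂P, Tendsto (fun m => relFreq X C m ω) atTop (𝓝 ((P.map (X 0)).real C)) := by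
  have hpath := hstat.aemeasurable_path
  have := Measure.isProbabilityMeasure_map hpath
  have hmeas : Measurable (C.indicator (1 : S → ℝ)) := measurable_one.indicator hC
  have hmeas_zero : Measurable fun x : ℕ → S => C.indicator (1 : S → ℝ) (x 0) :=
    hmeas.comp (measurable_pi_apply 0)
  have hint : Integrable (fun x : ℕ → S => C.indicator (1 : S → ℝ) (x 0))
      (P.map fun ω n => X n ω) :=
    .of_bound hmeas_zero.aestronglyMeasurable 1 (.of_forall fun x =>
      (norm_indicator_le_norm_self _ _).trans norm_one.le)
  have hlim := ae_of_ae_map hpath (ae_tendsto_birkhoffAverage (ergodic_shift hstat herg) hint)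
  rw [integral_map hpath hmeas_zero.aestronglyMeasurable,
    ← integral_map (hstat.aemeasurable 0) hmeas.aestronglyMeasurable,
    integral_indicator_one hC] at hlim
  simpa only [relFreq_eq_birkhoffAverage] using hlim

theorem ae_eventually_abs_relFreq_sub_lt (hstat : IsStationary X P) (herg : IsErgodic X P)
    {C : Set S} (hC : MeasurableSet C) {ε : ℝ} (hε : 0 < ε) :
    ∀ᵐ ω ∂P, ∀ᶠ m in atTop, |relFreq X C m ω - (P.map (X 0)).real C| < ε := by
  filter_upwards [ae_tendsto_relFreq hstat herg hC] with ω hω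
  exact hω.eventually (Metric.ball_mem_nhds _ hε)

theorem ae_eventually_Gam_le (hstat : IsStationary X P) (herg : IsErgodic X P)
    {𝒞 : Set (Set S)} (h𝒞 : 𝒞.Countable) (hmeas : ∀ C ∈ 𝒞, MeasurableSet C)
    (hdim : vcDim 𝒞 < ⊤) {ε : ℝ} (hε : 0 < ε) :
    ∀ᵐ ω ∂P, ∀ᶠ m in atTop, Gam P 𝒞 X m ω ≤ ε := by
  have hX₀ := hstat.aemeasurable 0
  have := Measure.isProbabilityMeasure_map hX₀
  obtain ⟨t, htI, ht, hcover⟩ := exists_finite_bracket_cover (μ := P.map (X 0)) hmeas hdim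
    (ε := ENNReal.ofReal (ε / 2)) (ENNReal.ofReal_pos.2 (half_pos hε))
  have hfreq : ∀ᵐ ω ∂P, ∀ p ∈ t, ∀ᶠ m in atTop,
      |relFreq X p.1 m ω - (P.map (X 0)).real p.1| < ε / 2 ∧
      |relFreq X p.2 m ω - (P.map (X 0)).real p.2| < ε / 2 := by
    refine (ae_ball_iff ht.countable).2 fun p hp => ?_
    filter_upwards [ae_eventually_abs_relFreq_sub_lt hstat herg (htI hp).1 (half_pos hε),
      ae_eventually_abs_relFreq_sub_lt hstat herg (htI hp).2.1 (half_pos hε)] with ω h₁ h₂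
    exact h₁.and h₂
  have hbracket : ∀ᵐ ω ∂P, ∀ C ∈ 𝒞, ∃ p ∈ t, C ∈ bracket (P.map (X 0)) p.1 p.2 ∧
      (∀ n, X n ω ∈ p.1 → X n ω ∈ C) ∧ ∀ n, X n ω ∈ C → X n ω ∈ p.2 := by
    refine (ae_ball_iff h𝒞).2 fun C hC => ?_
    obtain ⟨p, hp, hCp⟩ := Set.mem_iUnion₂.1 (hcover hC)
    filter_upwards [hstat.ae_forall_mem_imp hCp.1, hstat.ae_forall_mem_imp hCp.2] with ω h₁ h₂
    exact ⟨p, hp, hCp, h₁, h₂⟩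
  filter_upwards [hfreq, hbracket] with ω hω hωbracket
  filter_upwards [(eventually_all_finite ht).2 hω] with m hm
  refine Real.iSup_le (fun C => ?_) hε.le
  obtain ⟨p, hp, hCp, h₁, h₂⟩ := hωbracket C C.2
  rw [show P.real {ω' | X 0 ω' ∈ (C : Set S)} = (P.map (X 0)).real C from
    (map_measureReal_apply_of_aemeasurable hX₀ (hmeas C C.2)).symm]
  exact abs_relFreq_sub_measureReal_le hCp
    (ENNReal.toReal_le_of_le_ofReal (half_pos hε).le (htI hp).2.2.le) h₁ h₂ (hm p hp).1 (hm p hp).2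

end Sampling

end ErgodicVC

theorem theorem1_general {S : Type*} [MeasurableSpace S]
    (𝒞 : Set (Set S)) (h𝒞 : 𝒞.Countable) (hmeas : ∀ C ∈ 𝒞, MeasurableSet C)
    (hdim : ErgodicVC.vcDim 𝒞 < ⊤)
    {Ω : Type*} [MeasurableSpace Ω] (P : Measure Ω) [IsProbabilityMeasure P]
    (X : ℕ → Ω → S) (hstat : ErgodicVC.IsStationary X P) (herg : ErgodicVC.IsErgodic X P) :
    ErgodicVC.IsGlivenkoCantelli P 𝒞 X := by
  have hsmall : ∀ᵐ ω ∂P, ∀ k : ℕ, ∀ᶠ m in atTop,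
      ErgodicVC.Gam P 𝒞 X m ω ≤ 1 / ((k : ℝ) + 1) :=
    ae_all_iff.2 fun k =>
      ErgodicVC.ae_eventually_Gam_le hstat herg h𝒞 hmeas hdim Nat.one_div_pos_of_nat
  filter_upwards [hsmall] with ω hω
  refine Metric.nhds_basis_closedBall_inv_nat_succ.tendsto_right_iff.2 fun k _ =>
    (hω k).mono fun m hm => ?_
  have hnonneg : 0 ≤ ErgodicVC.Gam P 𝒞 X m ω := Real.iSup_nonneg fun C => abs_nonneg _
  rwa [mem_closedBall_zero_iff, Real.norm_of_nonneg hnonneg]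

theorem theorem1 {S : Type*} [MetricSpace S] [CompleteSpace S]
    [TopologicalSpace.SeparableSpace S] [MeasurableSpace S] [BorelSpace S]
    (𝒞 : Set (Set S)) (h𝒞 : 𝒞.Countable) (hmeas : ∀ C ∈ 𝒞, MeasurableSet C)
    (hdim : ErgodicVC.vcDim 𝒞 < ⊤)
    {Ω : Type*} [MeasurableSpace Ω] (P : Measure Ω) [IsProbabilityMeasure P]
    (X : ℕ → Ω → S) (hX : ∀ n, Measurable (X n))
    (hstat : ErgodicVC.IsStationary X P) (herg : ErgodicVC.IsErgodic X P) :
    ErgodicVC.IsGlivenkoCantelli P 𝒞 X :=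
  theorem1_general 𝒞 h𝒞 hmeas hdim P X hstat herg
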